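/- **Theorem.** Consider a graphical game with finitely many agents $1,\dots,m$. Agent $i$ has a finite set of $n_i$ actions, and each pair of distinct agents $i,k$ plays an edge-game given by matrices $\mathbf A^{ik}\in\mathbb R^{n_i\times n_k}$ and $\mathbf A^{ki}\in\mathbb R^{n_k\times n_i}$. When the agents play mixed strategies $\hat{\mathbf x}=(\mathbf x_1,\dots,\mathbf x_m)\in\Delta:=\Delta^{n_1}\times\cdots\times\Delta^{n_m}$, where $\Delta^{n}$ is the probability simplex in $\mathbb R^n$, the payoff vector of agent $i$ is $\mathbf p_i(\hat{\mathbf x})=\sum_{k\ne i}\mathbf A^{ik}\mathbf x_k$. Suppose that: * the game is constant-sum: for all $i\neq k$ there is a constant $c^{\{i,k\}}$ with $\mathbf A^{ik}_{j\ell}+\mathbf A^{ki}_{\ell j}=c^{\{i,k\}}$ for all actions $j$ of agent $i$ and $\ell$ of agent $k$; * the game has a Nash equilibrium $\hat{\mathbf x}^*\in\Delta$ that is fully mixed, i.e. all of whose entries are positive; * each agent $i$ uses a convex combination of finitely many continuous-time FTRL dynamics: her conversion function is $f_i=\sum_{\ell}\alpha_{i\ell}f_{i\ell}:\mathbb R^{n_i}\to\Delta^{n_i}$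 (a finite sum), with $\alpha_{i\ell}\ge 0$, $\sum_\ell\alpha_{i\ell}=1$ and $f_{i\ell}(\mathbf q)=\operatorname{argmax}_{\mathbf x\in\Delta^{n_i}}\{\langle\mathbf q,\mathbf x\rangle-h_{i\ell}(\mathbf x)\}$, where each regularizer $h_{i\ell}:\Delta^{n_i}\to\mathbb R$ is continuous and strictly convex. Consider the dynamical game system on the cumulative payoffs $\hat{\mathbf q}=(\mathbf q_1,\dots,\mathbf q_m)\in\mathbb R^{n_1}\times\cdots\times\mathbb R^{n_m}$, $$\dot{\mathbf q}_i(t)=\mathbf p_i(\hat{\mathbf x}(t)),\qquad \mathbf x_i(t)=f_i(\mathbf q_i(t)),\qquad t\ge 0,\ 1\le i\le m,$$ and suppose that its solutions on $[0,\infty)$ are determined by their initial condition $\hat{\mathbf q}(0)$. Then the system is Poincaré recurrent in the strategy space $\Delta$: 1. for almost every initial condition $\hat{\mathbf q}(0)$, with respect to Lebesgue measure, the solution exists for all $t\ge0$, and for every $\varepsilon>0$ there are arbitrarily large times $t$ with $\|\hat{\mathbf x}(t)-\hat{\mathbf x}(0)\|<\varepsilon$; 2. for every nonempty relatively open set $U\subseteq\Delta$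 there is a solution with $\hat{\mathbf x}(t)\in U$ for arbitrarily large times $t$. -/

import Mathlib

open Filter Topology MeasureTheory

/-- Profiles of mixed strategies, payoffs or cumulative payoffs of `m` agents, where agent `i` has
`n i` actions. -/
abbrev Profile {m : ℕ} (n : Fin m → ℕ) : Type := ∀ i : Fin m, Fin (n i) → ℝ

/-- The strategy space: the product of the probability simplices of the agents. -/
def strategySpace {m : ℕ} (n : Fin m → ℕ) : Set (Profile n) :=
  {x | ∀ i, x i ∈ stdSimplex ℝ (Fin (n i))}

/-- A regularizer: a real function, continuous and strictly convex on the probability simplex.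
Its values outside of the simplex are never used. -/
def IsRegularizer {d : ℕ} (h : (Fin d → ℝ) → ℝ) : Prop :=
  ContinuousOn h (stdSimplex ℝ (Fin d)) ∧ StrictConvexOn ℝ (stdSimplex ℝ (Fin d)) h

/-- `f` is the conversion function of an FTRL dynamic: for some regularizer `h` and for all `q`,
`f q` is the (unique) maximizer of `⟨q, x⟩ - h x` over the probability simplex. -/
def IsFTRL {d : ℕ} (f : (Fin d → ℝ) → (Fin d → ℝ)) : Prop :=
  ∃ h : (Fin d → ℝ) → ℝ, IsRegularizer h ∧
    ∀ q, f q ∈ stdSimplex ℝ (Fin d) ∧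
      IsMaxOn (fun x => q ⬝ᵥ x - h x) (stdSimplex ℝ (Fin d)) (f q)

/-- `f` is the conversion function of a convex combination of finitely many FTRL dynamics. -/
def IsConvexCombFTRL {d : ℕ} (f : (Fin d → ℝ) → (Fin d → ℝ)) : Prop :=
  ∃ (k : ℕ) (α : Fin k → ℝ) (g : Fin k → (Fin d → ℝ) → (Fin d → ℝ)),
    (∀ l, 0 ≤ α l) ∧ ∑ l, α l = 1 ∧ (∀ l, IsFTRL (g l)) ∧ ∀ q, f q = ∑ l, α l • g l q

/-- The edge-game matrices of a graphical game: `A i k` holds the payoffs of agent `i` in her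
edge-game against agent `k`. The diagonal blocks `A i i` are never used. -/
abbrev EdgeGames {m : ℕ} (n : Fin m → ℕ) : Type :=
  ∀ i k : Fin m, Matrix (Fin (n i)) (Fin (n k)) ℝ

/-- The payoff vectors of all agents in a graphical game, given the mixed strategies `x`. -/
def gamePayoff {m : ℕ} {n : Fin m → ℕ} (A : EdgeGames n) (x : Profile n) : Profile n :=
  fun i => ∑ k ∈ Finset.univ.erase i, (A i k).mulVec (x k)

/-- Every edge-game is constant-sum. -/
def IsConstantSum {m : ℕ} {n : Fin m → ℕ} (A : EdgeGames n) : Prop :=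
  ∀ i k : Fin m, i ≠ k → ∃ c : ℝ, ∀ j l, A i k j l + A k i l j = c

/-- `x` is a (mixed) Nash equilibrium: no agent gains from a unilateral deviation. The payoff
vector of agent `i` does not depend on her own strategy. -/
def IsNash {m : ℕ} {n : Fin m → ℕ} (A : EdgeGames n) (x : Profile n) : Prop :=
  x ∈ strategySpace n ∧
    ∀ i, ∀ y ∈ stdSimplex ℝ (Fin (n i)), y ⬝ᵥ gamePayoff A x i ≤ x i ⬝ᵥ gamePayoff A x i

/-- The strategy profile that the agents play at the cumulative payoffs `q`, when agent `i` uses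
the conversion function `f i`. -/
def strategyOf {m : ℕ} {n : Fin m → ℕ} (f : ∀ i, (Fin (n i) → ℝ) → (Fin (n i) → ℝ))
    (q : Profile n) : Profile n :=
  fun i => f i (q i)

/-- `q` is a trajectory on `[0, ∞)`, in cumulative payoffs, of the dynamical game system: the
derivative of `q` is the payoff of the strategies that are played at `q`. -/
def IsTrajectory {m : ℕ} {n : Fin m → ℕ} (A : EdgeGames n)
    (f : ∀ i, (Fin (n i) → ℝ) → (Fin (n i) → ℝ)) (q : ℝ → Profile n) : Prop :=
  ∀ t, 0 ≤ t → HasDerivWithinAt q (gamePayoff A (strategyOf f (q t))) (Set.Ici 0) t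

/-- Trajectories of the dynamical game system are determined by their initial condition. -/
def HasUniqueTrajectories {m : ℕ} {n : Fin m → ℕ} (A : EdgeGames n)
    (f : ∀ i, (Fin (n i) → ℝ) → (Fin (n i) → ℝ)) : Prop :=
  ∀ q r : ℝ → Profile n, IsTrajectory A f q → IsTrajectory A f r → q 0 = r 0 →
    ∀ t, 0 ≤ t → q t = r t

/-- Poincaré recurrence in the strategy space. First, for Lebesgue-almost every vector of initial
cumulative payoffs, the trajectory exists for all times and its strategy profile returns
arbitrarily close to the initial one at arbitrarily large times. Second, every nonempty relatively
open subset of the strategy space is visited at arbitrarily large times by some trajectory. -/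
def PoincareRecurrent {m : ℕ} {n : Fin m → ℕ} (A : EdgeGames n)
    (f : ∀ i, (Fin (n i) → ℝ) → (Fin (n i) → ℝ)) : Prop :=
  (∀ᵐ q₀ : Profile n ∂volume, ∃ q : ℝ → Profile n, IsTrajectory A f q ∧ q 0 = q₀ ∧
    ∀ ε > 0, ∃ᶠ t in atTop, dist (strategyOf f (q t)) (strategyOf f q₀) < ε) ∧
  (∀ U : Set (Profile n), IsOpen U → (U ∩ strategySpace n).Nonempty →
    ∃ q : ℝ → Profile n, IsTrajectory A f q ∧ ∃ᶠ t in atTop, strategyOf f (q t) ∈ U)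

/-! Poincaré's theorem needs a measure preserving map and invariant sets of finite measure; both
appear after a normalization. Each `f i` ignores constants added to its argument, so the payoff of
one fixed action `a i` may be subtracted from the payoffs of agent `i`. This leaves the strategies
unchanged and freezes the coordinates `q i (a i)`.

Volume: no agent's payoff depends on her own strategy, so the normalized field is a sum of fields
that depend on `q k` alone and have zero `k`-component. It is formally divergence free, but only
continuous, so Liouville's formula does not apply. Instead the flow is the limit of a splitting
scheme of shears, each volume preserving by Fubini (`measurePreserving_add_shear`). Compactness
gives limits that solve the equation, and the assumed uniqueness makes the scheme converge
(`IsConsistent.exists_flow`); volume preservation passes to the limit.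

Bounded invariant sets: with `Φ i` the combination of the convex conjugates of the regularizers and
`x` the fully mixed equilibrium, `∑ i, (Φ i (q i) - x i ⬝ᵥ q i)` is conserved, because its
derivative `∑ i, (f i (q i) - x i) ⬝ᵥ p i`, where `p` denotes the payoffs, vanishes in a
constant-sum game. As `x` is positive, the energy bounds coordinate differences, and the frozen
coordinates bound the rest.

For the second claim, positive strategies are dense in the strategy space and are all played at some
`q`. So the `q` whose strategy lies in `U` form a nonempty open set, which meets the full measure
set of recurrent points. -/

/-- `r` solves the autonomous differential equation of the vector field `V` on `[0, ∞)`. -/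
def IsSolution {E : Type*} [NormedAddCommGroup E] [NormedSpace ℝ E] (V : E → E) (r : ℝ → E) :
    Prop :=
  ∀ t, 0 ≤ t → HasDerivWithinAt r (V (r t)) (Set.Ici 0) t

/-- The one-step maps `S h` move points by at most `M * h`, and they are consistent with the
vector field `V`, locally uniformly. -/
structure IsConsistent {E : Type*} [NormedAddCommGroup E] [NormedSpace ℝ E]
    (S : ℝ → E → E) (V : E → E) (M : ℝ) : Prop where
  nonneg : 0 ≤ M
  displacement : ∀ h, 0 ≤ h → ∀ x, ‖S h x - x‖ ≤ M * h
  approx : ∀ p, ∀ ε > 0, ∃ δ > 0, ∀ h, 0 ≤ h → h < δ → ∀ x, ‖x - p‖ < δ →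
    ‖S h x - x - h • V p‖ ≤ ε * h

/-- The state at time `t` of the scheme with `N + 1` steps per unit of time. -/
noncomputable def schemeAt {E : Type*} (S : ℝ → E → E) (N : ℕ) (t : ℝ) : E → E :=
  (S (1 / (N + 1 : ℝ)))^[⌊t * (N + 1)⌋₊]

/-- Each of the two floors loses less than one step, so the number of steps between them is off by
at most one. -/
theorem exists_schemeAt_eq_iterate {E : Type*} (S : ℝ → E → E) (N : ℕ) {a b : ℝ} (ha : 0 ≤ a) (hab : a ≤ b)
    (x : E) :
    ∃ j : ℕ, schemeAt S N b x = (S (1 / (N + 1 : ℝ)))^[j] (schemeAt S N a x) ∧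
      |j * (1 / (N + 1 : ℝ)) - (b - a)| ≤ 1 / (N + 1 : ℝ) := by
  have hN : (0 : ℝ) < N + 1 := by positivity
  have hle : ⌊a * (N + 1)⌋₊ ≤ ⌊b * (N + 1)⌋₊ := Nat.floor_le_floor (by gcongr)
  refine ⟨⌊b * (N + 1)⌋₊ - ⌊a * (N + 1)⌋₊, ?_, ?_⟩
  · rw [schemeAt, schemeAt, ← Function.iterate_add_apply, Nat.sub_add_cancel hle]
  · have h1 := Nat.floor_le (show 0 ≤ a * (N + 1) by positivity)
    have h2 := Nat.lt_floor_add_one (a * (N + 1))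
    have h3 := Nat.floor_le (show 0 ≤ b * (N + 1) from mul_nonneg (ha.trans hab) hN.le)
    have h4 := Nat.lt_floor_add_one (b * (N + 1))
    rw [Nat.cast_sub hle]
    have : ((⌊b * (N + 1)⌋₊ : ℝ) - ⌊a * (N + 1)⌋₊) * (1 / (N + 1 : ℝ)) - (b - a)
        = ((⌊b * (N + 1)⌋₊ - b * (N + 1)) - (⌊a * (N + 1)⌋₊ - a * (N + 1))) * (1 / (N + 1)) := by
      field_simp; ring
    rw [this, abs_mul, abs_of_pos (show 0 < 1 / (N + 1 : ℝ) by positivity)]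
    refine mul_le_of_le_one_left (by positivity) ?_
    rw [abs_le]; constructor <;> linarith

/-! ### Consistent one-step schemes and their limits -/

section Consistent

variable {E : Type*} [NormedAddCommGroup E] [NormedSpace ℝ E]

theorem IsConsistent.id : IsConsistent (fun _ x => x) (fun _ : E => (0 : E)) 0 where
  nonneg := le_rfl
  displacement h _ x := by simp
  approx p ε hε := ⟨1, one_pos, fun h hh _ x _ => by simpa using mul_nonneg hε.le hh⟩

/-- Both errors are measured against fields frozen at the same `p`, so they simply add; it only
matters that the intermediate point `S h x` is still near `p`. -/
theorem IsConsistent.comp {S S' : ℝ → E → E} {V V' : E → E} {M M' : ℝ}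
    (hS : IsConsistent S V M) (hS' : IsConsistent S' V' M') :
    IsConsistent (fun h x => S' h (S h x)) (fun x => V' x + V x) (M' + M) where
  nonneg := add_nonneg hS'.nonneg hS.nonneg
  displacement h hh x := by
    have h1 := hS'.displacement h hh (S h x)
    have h2 := hS.displacement h hh x
    calc ‖S' h (S h x) - x‖ = ‖(S' h (S h x) - S h x) + (S h x - x)‖ := by congr 1; abel
      _ ≤ M' * h + M * h := (norm_add_le _ _).trans (add_le_add h1 h2)
      _ = (M' + M) * h := by ring
  approx p ε hε := by
    obtain ⟨δ, hδ, h1⟩ := hS.approx p (ε / 2) (half_pos hε)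
    obtain ⟨δ', hδ', h2⟩ := hS'.approx p (ε / 2) (half_pos hε)
    have hM : 0 < M + 1 := by linarith [hS.nonneg]
    refine ⟨min (δ / 1) (min (δ' / 2) (δ' / 2 / (M + 1))), by positivity, fun h hh hlt x hx => ?_⟩
    simp only [lt_min_iff, div_one] at hlt hx
    have hMh : M * h < δ' / 2 := by
      have := (lt_div_iff₀ hM).1 hlt.2.2
      nlinarith
    have hy : ‖S h x - p‖ < δ' := by
      calc ‖S h x - p‖ = ‖(S h x - x) + (x - p)‖ := by congr 1; abel
        _ ≤ ‖S h x - x‖ + ‖x - p‖ := norm_add_le _ _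
        _ < δ' := by linarith [hS.displacement h hh x, hx.2.1]
    have e1 := h1 h hh hlt.1 x hx.1
    have e2 := h2 h hh (by linarith [hlt.2.1]) _ hy
    calc ‖S' h (S h x) - x - h • (V' p + V p)‖
        = ‖(S' h (S h x) - S h x - h • V' p) + (S h x - x - h • V p)‖ := by
          congr 1; rw [smul_add]; abel
      _ ≤ ε / 2 * h + ε / 2 * h := (norm_add_le _ _).trans (add_le_add e2 e1)
      _ = ε * h := by ring

theorem IsConsistent.euler {W : E → E} {M : ℝ} (hW : Continuous W) (hM : ∀ x, ‖W x‖ ≤ M) :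
    IsConsistent (fun h x => x + h • W x) W M where
  nonneg := (norm_nonneg _).trans (hM 0)
  displacement h hh x := by
    rw [add_sub_cancel_left, norm_smul, Real.norm_of_nonneg hh, mul_comm]
    exact mul_le_mul_of_nonneg_right (hM x) hh
  approx p ε hε := by
    obtain ⟨δ, hδ, H⟩ := Metric.continuous_iff.1 hW p ε hε
    refine ⟨δ, hδ, fun h hh _ x hx => ?_⟩
    rw [add_sub_cancel_left, ← smul_sub, norm_smul, Real.norm_of_nonneg hh, mul_comm]
    refine mul_le_mul_of_nonneg_right ?_ hh
    have := H x (by rwa [dist_eq_norm])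
    rw [dist_eq_norm] at this
    exact this.le

variable {S : ℝ → E → E} {V : E → E} {M : ℝ}

theorem IsConsistent.norm_iterate_sub_le (hS : IsConsistent S V M) {h : ℝ} (hh : 0 ≤ h) (x : E)
    (j : ℕ) : ‖(S h)^[j] x - x‖ ≤ M * (j * h) := by
  induction j with
  | zero => simp
  | succ j ih =>
    rw [Function.iterate_succ_apply']
    calc _ = ‖(S h ((S h)^[j] x) - (S h)^[j] x) + ((S h)^[j] x - x)‖ := by congr 1; abel
      _ ≤ M * h + M * (j * h) :=
        (norm_add_le _ _).trans (add_le_add (hS.displacement h hh _) ih)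
      _ = _ := by push_cast; ring

/-- The one-step errors telescope, since every step is compared with the same vector `V p`. -/
theorem norm_iterate_sub_sub_le {p : E} {ε δ h : ℝ}
    (hδ : ∀ x, ‖x - p‖ < δ → ‖S h x - x - h • V p‖ ≤ ε * h) (x : E) (j : ℕ)
    (hx : ∀ i < j, ‖(S h)^[i] x - p‖ < δ) :
    ‖(S h)^[j] x - x - (j * h) • V p‖ ≤ ε * (j * h) := by
  induction j with
  | zero => simp
  | succ j ih =>
    rw [Function.iterate_succ_apply']
    calc _ = ‖(S h ((S h)^[j] x) - (S h)^[j] x - h • V p)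
            + ((S h)^[j] x - x - (j * h) • V p)‖ := by
          congr 1; push_cast; rw [add_mul, add_smul, one_mul]; abel
      _ ≤ ε * h + ε * (j * h) :=
        (norm_add_le _ _).trans (add_le_add (hδ _ (hx j j.lt_succ_self))
          (ih fun i hi => hx i (hi.trans j.lt_succ_self)))
      _ = _ := by push_cast; ring

theorem IsConsistent.norm_schemeAt_sub_le (hS : IsConsistent S V M) (N : ℕ) {t : ℝ} (ht : 0 ≤ t)
    (x : E) : ‖schemeAt S N t x - x‖ ≤ M * t := by
  refine (hS.norm_iterate_sub_le (by positivity) x _).trans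
    (mul_le_mul_of_nonneg_left ?_ hS.nonneg)
  rw [mul_one_div, div_le_iff₀ (by positivity)]
  exact Nat.floor_le (by positivity)

/-- The limit of the scheme along an ultrafilter satisfies the differential equation. -/
theorem IsConsistent.isSolution_of_tendsto (hS : IsConsistent S V M) {x : E} {𝒰 : Ultrafilter ℕ}
    (h𝒰 : (𝒰 : Filter ℕ) ≤ atTop) {y : ℝ → E}
    (hy : ∀ t, 0 ≤ t → Tendsto (fun N => schemeAt S N t x) 𝒰 (𝓝 (y t))) :
    IsSolution V y := by
  have hM : 0 < M + 1 := by linarith [hS.nonneg]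
  have hh : Tendsto (fun N : ℕ => 1 / (N + 1 : ℝ)) 𝒰 (𝓝 0) :=
    tendsto_one_div_add_atTop_nhds_zero_nat.mono_left h𝒰
  -- Taking `a = s` or `b = s` gives the right and the left difference quotient at once.
  have main : ∀ s, 0 ≤ s → ∀ ε > 0, ∃ η > 0, ∀ a b, 0 ≤ a → s - η < a → a ≤ s → s ≤ b →
      b < s + η → ‖y b - y a - (b - a) • V (y s)‖ ≤ ε * (b - a) := by
    intro s hs ε hε
    obtain ⟨δ, hδ, H⟩ := hS.approx (y s) ε hε
    -- Distance budget to `y s`: drift from `a` over `b - a` costs `δ / 2`, over `s - a` costs `δ /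
    -- 4`, the two rounding errors `δ / 16` each, and the convergence at `s` less than `δ / 8`.
    refine ⟨δ / 4 / (M + 1), by positivity, fun a b ha has has' hsb hsb' => ?_⟩
    have hη : M * (δ / 4 / (M + 1)) ≤ δ / 4 := by
      rw [← mul_div_assoc, div_le_iff₀ hM]; nlinarith
    have hab : a ≤ b := has'.trans hsb
    choose j hj hj' using fun N => exists_schemeAt_eq_iterate S N ha hab x
    have hlim : Tendsto (fun N => (j N : ℝ) * (1 / (N + 1 : ℝ))) 𝒰 (𝓝 (b - a)) := by
      rw [tendsto_iff_dist_tendsto_zero]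
      exact squeeze_zero (fun _ => dist_nonneg) (fun N => hj' N) hh
    have hL := ((hy b (ha.trans hab)).sub (hy a ha)).sub (hlim.smul_const (V (y s)))
    refine le_of_tendsto_of_tendsto hL.norm (hlim.const_mul ε) ?_
    have e1 : ∀ᶠ N in (𝒰 : Filter ℕ), ‖schemeAt S N s x - y s‖ < δ / 8 := by
      have := (tendsto_iff_dist_tendsto_zero.1 (hy s hs)).eventually
        (gt_mem_nhds (show 0 < δ / 8 by positivity))
      simpa only [dist_eq_norm] using this
    have e2 := hh.eventually (gt_mem_nhds (show 0 < min δ (δ / 16 / (M + 1)) by positivity))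
    filter_upwards [e1, e2] with N h1 h2
    have hN : 0 ≤ 1 / (N + 1 : ℝ) := by positivity
    rw [lt_min_iff] at h2
    have hMN : M * (1 / (N + 1 : ℝ)) ≤ δ / 16 := by
      have := (lt_div_iff₀ hM).1 h2.2
      nlinarith
    rw [hj]
    refine norm_iterate_sub_sub_le (fun z hz => H _ hN h2.1 z hz) _ _ fun i hi => ?_
    obtain ⟨k, hk, hk'⟩ := exists_schemeAt_eq_iterate S N ha has' x
    have d1 := hS.norm_iterate_sub_le hN (schemeAt S N a x) i
    have d2 := hS.norm_iterate_sub_le hN (schemeAt S N a x) k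
    rw [← hk] at d2
    have i1 : (i : ℝ) * (1 / (N + 1)) ≤ (b - a) + 1 / (N + 1) := by
      have : (i : ℝ) * (1 / (N + 1)) ≤ j N * (1 / (N + 1)) := by
        have : (i : ℝ) ≤ j N := by exact_mod_cast hi.le
        gcongr
      linarith [(abs_le.1 (hj' N)).2]
    have i2 : (k : ℝ) * (1 / (N + 1)) ≤ (s - a) + 1 / (N + 1) := by
      linarith [(abs_le.1 hk').2]
    have b1 := mul_le_mul_of_nonneg_left i1 hS.nonneg
    have b2 := mul_le_mul_of_nonneg_left i2 hS.nonneg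
    have b3 : M * (b - a) ≤ M * (2 * (δ / 4 / (M + 1))) :=
      mul_le_mul_of_nonneg_left (by linarith) hS.nonneg
    have b4 : M * (s - a) ≤ M * (δ / 4 / (M + 1)) :=
      mul_le_mul_of_nonneg_left (by linarith) hS.nonneg
    have hη' : 0 ≤ δ / 4 / (M + 1) := by positivity
    calc ‖(S (1 / (N + 1 : ℝ)))^[i] (schemeAt S N a x) - y s‖
        = ‖((S (1 / (N + 1 : ℝ)))^[i] (schemeAt S N a x) - schemeAt S N a x)
            + -(schemeAt S N s x - schemeAt S N a x) + (schemeAt S N s x - y s)‖ := by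
          congr 1; abel
      _ ≤ _ := norm_add₃_le
      _ < δ := by rw [norm_neg]; linarith
  intro s hs
  rw [hasDerivWithinAt_iff_isLittleO, Asymptotics.isLittleO_iff]
  intro ε hε
  obtain ⟨η, hη, H⟩ := main s hs ε hε
  filter_upwards [self_mem_nhdsWithin, mem_nhdsWithin_of_mem_nhds (Metric.ball_mem_nhds s hη)]
    with t ht ht'
  rw [Real.ball_eq_Ioo] at ht'
  rcases le_total s t with hst | hst
  · have := H s t hs (by linarith) le_rfl hst ht'.2
    rwa [Real.norm_of_nonneg (sub_nonneg.2 hst)]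
  · have := H t s ht ht'.1 hst le_rfl (by linarith)
    rw [norm_sub_rev t s, Real.norm_of_nonneg (sub_nonneg.2 hst), ← norm_neg]
    have e : -(y t - y s - (t - s) • V (y s)) = y s - y t - (s - t) • V (y s) := by
      rw [← neg_sub s t, neg_smul]; abel
    rwa [e]

end Consistent

/-! ### Existence of the flow and preservation of measure -/

section Flow

variable {E : Type*} [NormedAddCommGroup E] [NormedSpace ℝ E] [ProperSpace E]
  {S : ℝ → E → E} {V : E → E} {M : ℝ}

/-- Peano's theorem: bounded displacement keeps the scheme at time `t` in a compact ball, and a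
single ultrafilter converges at all times together, so no subsequences have to be extracted. -/
theorem IsConsistent.exists_isSolution (hS : IsConsistent S V M) (x : E) {𝒰 : Ultrafilter ℕ}
    (h𝒰 : (𝒰 : Filter ℕ) ≤ atTop) :
    ∃ y : ℝ → E, IsSolution V y ∧ y 0 = x ∧
      ∀ t, 0 ≤ t → Tendsto (fun N => schemeAt S N t x) 𝒰 (𝓝 (y t)) := by
  have : ∀ t : ℝ, ∃ z, 0 ≤ t → Tendsto (fun N => schemeAt S N t x) 𝒰 (𝓝 z) := by
    intro t
    by_cases ht : 0 ≤ t
    · have hK := isCompact_closedBall x (M * t)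
      obtain ⟨z, -, hz⟩ := isCompact_iff_ultrafilter_le_nhds'.1 hK
        (𝒰.map fun N => schemeAt S N t x) (Ultrafilter.mem_map.2 (univ_mem' fun N => by
          simpa [dist_eq_norm] using hS.norm_schemeAt_sub_le N ht x))
      exact ⟨z, fun _ => hz⟩
    · exact ⟨0, fun h => absurd h ht⟩
  choose y hy using this
  refine ⟨y, hS.isSolution_of_tendsto h𝒰 hy, ?_, hy⟩
  refine tendsto_nhds_unique (hy 0 le_rfl) ?_
  simp [schemeAt]

/-- If solutions are determined by their initial condition, the scheme converges to a flow. -/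
theorem IsConsistent.exists_flow (hS : IsConsistent S V M)
    (huniq : ∀ r r' : ℝ → E, IsSolution V r → IsSolution V r' → r 0 = r' 0 →
      ∀ t, 0 ≤ t → r t = r' t) :
    ∃ Φ : E → ℝ → E, ∀ x, IsSolution V (Φ x) ∧ Φ x 0 = x ∧
      ∀ t, 0 ≤ t → Tendsto (fun N => schemeAt S N t x) atTop (𝓝 (Φ x t)) := by
  -- One ultrafilter defines the flow. Any other yields a solution from the same point, hence the
  -- same limit, which is convergence along `atTop`.
  have h0 : ((hyperfilter ℕ : Ultrafilter ℕ) : Filter ℕ) ≤ atTop := Nat.hyperfilter_le_atTop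
  choose Φ h1 h2 _ using fun x => hS.exists_isSolution x h0
  refine ⟨Φ, fun x => ⟨h1 x, h2 x, fun t ht => (tendsto_iff_ultrafilter _ _ _).2 fun 𝒰 h𝒰 => ?_⟩⟩
  obtain ⟨y, hy, hy0, hlim⟩ := hS.exists_isSolution x h𝒰
  rw [huniq (Φ x) y (h1 x) hy ((h2 x).trans hy0.symm) t ht]
  exact hlim t ht

theorem IsSolution.comp_add {E : Type*} [NormedAddCommGroup E] [NormedSpace ℝ E] {V : E → E}
    {r : ℝ → E} (hr : IsSolution V r) {s : ℝ} (hs : 0 ≤ s) : IsSolution V fun t => r (t + s) := by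
  intro t ht
  have h := hr (t + s) (add_nonneg ht hs)
  have h2 : HasDerivWithinAt (fun t : ℝ => t + s) 1 (Set.Ici 0) t :=
    ((hasDerivAt_id t).add_const s).hasDerivWithinAt
  simpa [Function.comp_def] using
    h.scomp t h2 (fun u (hu : 0 ≤ u) => show 0 ≤ u + s from add_nonneg hu hs)

/-- The equation is autonomous, so uniqueness identifies the solution restarted at `Φ x k` with the
time shift of `Φ x`. -/
theorem iterate_flow_one {E : Type*} [NormedAddCommGroup E] [NormedSpace ℝ E] {V : E → E}
    (huniq : ∀ r r' : ℝ → E, IsSolution V r → IsSolution V r' → r 0 = r' 0 →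
      ∀ t, 0 ≤ t → r t = r' t) {Φ : E → ℝ → E}
    (hΦ : ∀ x, IsSolution V (Φ x) ∧ Φ x 0 = x) (k : ℕ) (x : E) :
    (fun z => Φ z 1)^[k] x = Φ x k := by
  induction k with
  | zero => simp [(hΦ x).2]
  | succ k ih =>
    rw [Function.iterate_succ_apply', ih]
    have := huniq (Φ (Φ x k)) (fun t => Φ x (t + k)) (hΦ _).1 ((hΦ x).1.comp_add k.cast_nonneg)
      (by simp [(hΦ _).2]) 1 zero_le_one
    rw [this]; push_cast; rw [add_comm]

/-- A pointwise limit of measure preserving maps with bounded displacement preserves the measure. -/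
theorem measurePreserving_of_tendsto {E : Type*} [NormedAddCommGroup E] [ProperSpace E]
    [MeasurableSpace E] [BorelSpace E] {μ : Measure E}
    [IsFiniteMeasureOnCompacts μ] {T : ℕ → E → E} {φ : E → E} {M : ℝ}
    (hT : ∀ N, MeasurePreserving (T N) μ μ) (hM : ∀ N x, ‖T N x - x‖ ≤ M)
    (hφ : ∀ x, Tendsto (fun N => T N x) atTop (𝓝 (φ x))) : MeasurePreserving φ μ μ := by
  have hmeas : Measurable φ :=
    measurable_of_tendsto_metrizable (fun N => (hT N).measurable) (tendsto_pi_nhds.2 hφ)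
  have hdisp : ∀ x, ‖φ x - x‖ ≤ M := fun x =>
    le_of_tendsto ((hφ x).sub_const x).norm (Eventually.of_forall fun N => hM N x)
  -- Testing against compactly supported functions needs a locally finite image measure; bounded
  -- displacement puts preimages of bounded sets in larger balls.
  have hfin : IsFiniteMeasureOnCompacts (μ.map φ) := by
    refine ⟨fun K hK => ?_⟩
    rw [Measure.map_apply hmeas hK.measurableSet]
    obtain ⟨R, hR⟩ := hK.isBounded.exists_norm_le
    refine (measure_mono fun x hx => ?_).trans_lt
      (isCompact_closedBall (0 : E) (R + M)).measure_lt_top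
    rw [mem_closedBall_zero_iff]
    calc ‖x‖ = ‖φ x - (φ x - x)‖ := by congr 1; abel
      _ ≤ R + M := (norm_sub_le _ _).trans (add_le_add (hR _ hx) (hdisp x))
  refine ⟨hmeas, Measure.ext_of_integral_eq_on_compactlySupported fun g => ?_⟩
  have hmap : ∀ {ψ : E → E}, Measurable ψ → ∫ x, g x ∂μ.map ψ = ∫ x, g (ψ x) ∂μ := fun hψ =>
    integral_map hψ.aemeasurable g.continuous.aestronglyMeasurable
  rw [hmap hmeas]
  obtain ⟨R, hR⟩ := g.hasCompactSupport.isCompact.isBounded.exists_norm_le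
  obtain ⟨C, hC⟩ := g.hasCompactSupport.exists_bound_of_continuous g.continuous
  have hball := (isCompact_closedBall (0 : E) (R + M)).measure_lt_top (μ := μ)
  -- All the functions `g ∘ T N` vanish outside one ball, which supplies the dominating function.
  have hlim : Tendsto (fun N => ∫ x, g (T N x) ∂μ) atTop (𝓝 (∫ x, g (φ x) ∂μ)) := by
    refine tendsto_integral_of_dominated_convergence
      ((Metric.closedBall (0 : E) (R + M)).indicator fun _ => C)
      (fun N => (g.continuous.measurable.comp (hT N).measurable).aestronglyMeasurable)
      ((integrable_indicator_iff measurableSet_closedBall).2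
        (integrableOn_const hball.ne)) (fun N => Eventually.of_forall fun x => ?_)
      (Eventually.of_forall fun x => (g.continuous.tendsto _).comp (hφ x))
    by_cases hx : x ∈ Metric.closedBall (0 : E) (R + M)
    · rw [Set.indicator_of_mem hx]; exact hC _
    · have : g (T N x) = 0 := by
        refine image_eq_zero_of_notMem_tsupport (f := g) fun h => ?_
        refine hx (mem_closedBall_zero_iff.2 ?_)
        calc ‖x‖ = ‖T N x - (T N x - x)‖ := by congr 1; abel
          _ ≤ R + M := (norm_sub_le _ _).trans (add_le_add (hR _ h) (hM N x))
      rw [Set.indicator_of_notMem hx, this, norm_zero]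
  refine tendsto_nhds_unique hlim ?_
  have : ∀ N, ∫ x, g (T N x) ∂μ = ∫ x, g x ∂μ := fun N => by
    rw [← hmap (hT N).measurable, (hT N).map_eq]
  simp_rw [this]
  exact tendsto_const_nhds

theorem IsConsistent.measurePreserving_flow [MeasurableSpace E] [BorelSpace E] {μ : Measure E}
    [IsFiniteMeasureOnCompacts μ] (hS : IsConsistent S V M)
    (hμ : ∀ h, MeasurePreserving (S h) μ μ) {φ : E → E} {t : ℝ} (ht : 0 ≤ t)
    (hφ : ∀ x, Tendsto (fun N => schemeAt S N t x) atTop (𝓝 (φ x))) : MeasurePreserving φ μ μ :=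
  measurePreserving_of_tendsto (fun _ => (hμ _).iterate _)
    (fun _ x => hS.norm_schemeAt_sub_le _ ht x) hφ

end Flow

/-! ### Recurrence, and volume preserving splitting schemes -/

/-- A volume preserving map with a continuous invariant whose sublevel sets are bounded is
recurrent. -/
theorem MeasureTheory.MeasurePreserving.ae_frequently_mem_of_isBounded_sublevel {E : Type*}
    [NormedAddCommGroup E] [ProperSpace E] [MeasurableSpace E] [BorelSpace E] {μ : Measure E}
    [IsFiniteMeasureOnCompacts μ] {φ : E → E} (hφ : MeasurePreserving φ μ μ) {G : E → ℝ}
    (hG : Continuous G) (hb : ∀ R : ℝ, Bornology.IsBounded {x | G x ≤ R})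
    (hinv : ∀ x, G (φ x) = G x) :
    ∀ᵐ x ∂μ, ∀ s ∈ 𝓝 x, ∃ᶠ k in atTop, φ^[k] x ∈ s := by
  -- Each sublevel set is its own preimage and has finite measure, so Poincaré recurrence applies to
  -- the restriction; countably many of them cover the space.
  have hK : ∀ N : ℕ, ∀ᵐ x ∂μ.restrict {x | G x ≤ N}, ∀ s ∈ 𝓝 x, ∃ᶠ k in atTop, φ^[k] x ∈ s := by
    intro N
    have hpre : φ ⁻¹' {x | G x ≤ N} = {x | G x ≤ N} := by ext x; simp [hinv]
    have h := hφ.restrict_preimage (isClosed_le hG (continuous_const (y := (N : ℝ)))).measurableSet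
    rw [hpre] at h
    have : IsFiniteMeasure (μ.restrict {x | G x ≤ N}) :=
      isFiniteMeasure_restrict.2 (hb N).measure_lt_top.ne
    exact h.conservative.ae_frequently_mem_of_mem_nhds
  have := (ae_restrict_iUnion_iff _ _).2 hK
  have hU : ⋃ N : ℕ, {x | G x ≤ N} = Set.univ :=
    Set.iUnion_eq_univ_iff.2 fun x => exists_nat_ge (G x)
  rwa [hU, Measure.restrict_univ] at this

/-- Shears of a product space along the coordinate `k` preserve the volume. -/
theorem measurePreserving_add_shear {m : ℕ} {n : Fin m → ℕ} (k : Fin m)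
    {w : (Fin (n k) → ℝ) → Profile n} (hw : Measurable w) (hwk : ∀ x, w x k = 0) :
    MeasurePreserving (fun q : Profile n => q + w (q k)) volume volume := by
  classical
  obtain ⟨p, hp⟩ : ∃ p : Fin m → Prop, ∀ i, p i ↔ i = k := ⟨(· = k), fun _ => Iff.rfl⟩
  have he := volume_preserving_piEquivPiSubtypeProd (fun i : Fin m => Fin (n i) → ℝ) p
  set e := MeasurableEquiv.piEquivPiSubtypeProd (fun i : Fin m => Fin (n i) → ℝ) p
  -- Over a fixed value of `q k` the shear translates the other coordinates: a skew product with
  -- measure preserving fibres.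
  let g : (∀ i : {i // p i}, Fin (n i) → ℝ) → (∀ i : {i // ¬ p i}, Fin (n i) → ℝ) →
    (∀ i : {i // ¬ p i}, Fin (n i) → ℝ) := fun a b i => b i + w (a ⟨k, (hp k).2 rfl⟩) i
  have hg : Measurable (Function.uncurry g) := by
    refine measurable_pi_iff.2 fun i => ?_
    have h1 : Measurable fun p : (∀ i : {i // p i}, Fin (n i) → ℝ) ×
        (∀ i : {i // ¬ p i}, Fin (n i) → ℝ) => w (p.1 ⟨k, (hp k).2 rfl⟩) :=
      hw.comp ((measurable_pi_apply _).comp measurable_fst)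
    exact ((measurable_pi_apply i).comp measurable_snd).add ((measurable_pi_apply i.1).comp h1)
  have hs := (MeasurePreserving.id (volume : Measure (∀ i : {i // p i}, Fin (n i) → ℝ))).skew_product
    (μc := volume) (μd := volume) hg (Eventually.of_forall fun a =>
      map_add_right_eq_self volume (fun i : {i // ¬ p i} => w (a ⟨k, (hp k).2 rfl⟩) i))
  rw [← Measure.volume_eq_prod] at hs
  have heq : (fun q : Profile n => q + w (q k)) = e.symm ∘ (fun p => (id p.1, g p.1 p.2)) ∘ e := by
    funext q i
    by_cases hi : p i
    · obtain rfl := (hp i).1 hi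
      simp [e, MeasurableEquiv.piEquivPiSubtypeProd, Equiv.piEquivPiSubtypeProd, hi, hwk]
    · simp [e, MeasurableEquiv.piEquivPiSubtypeProd, Equiv.piEquivPiSubtypeProd, hi, g]
  rw [heq]
  exact (he.symm e).comp (hs.comp he)

/-- A sum of bounded continuous fields, each of which is a shear along one coordinate, admits a
consistent volume preserving scheme. -/
theorem exists_isConsistent_measurePreserving {m : ℕ} {n : Fin m → ℕ}
    {w : ∀ k, (Fin (n k) → ℝ) → Profile n} (hw : ∀ k, Continuous (w k))
    (hb : ∀ k, ∃ M, ∀ x, ‖w k x‖ ≤ M) (hwk : ∀ k x, w k x k = 0) :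
    ∃ S M, IsConsistent S (fun q : Profile n => ∑ k, w k (q k)) M ∧
      ∀ h, MeasurePreserving (S h) volume volume := by
  suffices ∀ s : Finset (Fin m), ∃ S M, IsConsistent S (fun q : Profile n => ∑ k ∈ s, w k (q k)) M ∧
      ∀ h, MeasurePreserving (S h) volume volume from this Finset.univ
  intro s
  induction s using Finset.induction_on with
  | empty =>
    refine ⟨fun _ q => q, 0, ?_, fun _ => MeasurePreserving.id _⟩
    simpa using IsConsistent.id
  | insert k s hk ih =>
    obtain ⟨S, M, h1, h2⟩ := ih
    obtain ⟨M', hM'⟩ := hb k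
    -- An Euler step for the single field `w k` is a shear; one for the whole sum need not preserve
    -- volume, hence the splitting.
    have he : IsConsistent (fun (h : ℝ) (q : Profile n) => q + h • w k (q k))
        (fun q => w k (q k)) M' :=
      IsConsistent.euler ((hw k).comp (continuous_apply k)) fun q => hM' _
    refine ⟨_, M' + M, ?_, fun h => (measurePreserving_add_shear k (w := fun x => h • w k x)
      ((hw k).const_smul h).measurable (fun x => by simp [hwk])).comp (h2 h)⟩
    simpa [Finset.sum_insert hk] using! h1.comp he

/-! ### Convex potentials of FTRL dynamics -/

section Potential

variable {d : ℕ} {f : (Fin d → ℝ) → (Fin d → ℝ)} {Φ : (Fin d → ℝ) → ℝ}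

/-- `f` is a continuous selection of subgradients of `Φ` with values in the simplex, invariant
under translations along the diagonal, and `Φ` grows at least like the maximal coordinate. -/
structure IsPotential (f : (Fin d → ℝ) → (Fin d → ℝ)) (Φ : (Fin d → ℝ) → ℝ) : Prop where
  continuous : Continuous f
  mem : ∀ q, f q ∈ stdSimplex ℝ (Fin d)
  subgradient : ∀ q q', f q ⬝ᵥ (q' - q) ≤ Φ q' - Φ q
  shift : ∀ q c, f (fun j => q j + c) = f q
  growth : ∃ C, ∀ q j, q j - C ≤ Φ q

theorem dotProduct_const_of_mem_stdSimplex {x : Fin d → ℝ} (hx : x ∈ stdSimplex ℝ (Fin d))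
    (c : ℝ) : x ⬝ᵥ (fun _ => c) = c := by
  simp [dotProduct, ← Finset.sum_mul, hx.2]

/-- `Φ` is the convex conjugate of the regularizer on the simplex, and maximizers are its
subgradients. Adding `c` to all entries of `q` shifts the objective by `c`; growth follows by
testing the vertices of the simplex. -/
theorem IsFTRL.exists_isPotential (hf : IsFTRL f) : ∃ Φ, IsPotential f Φ := by
  obtain ⟨h, ⟨hcont, hconv⟩, hmax⟩ := hf
  have hval : ∀ q, ∀ x ∈ stdSimplex ℝ (Fin d), q ⬝ᵥ x - h x ≤ q ⬝ᵥ f q - h (f q) :=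
    fun q x hx => (hmax q).2 hx
  have huniq : ∀ q, ∀ y ∈ stdSimplex ℝ (Fin d),
      (∀ x ∈ stdSimplex ℝ (Fin d), q ⬝ᵥ x - h x ≤ q ⬝ᵥ y - h y) → f q = y := by
    intro q y hy hmy
    have hlin : ConcaveOn ℝ (stdSimplex ℝ (Fin d)) fun x => q ⬝ᵥ x :=
      ⟨convex_stdSimplex ℝ _, fun x _ y _ a b _ _ _ => by
        simp [dotProduct_add, dotProduct_smul]⟩
    exact (hlin.sub_strictConvexOn hconv).eq_of_isMaxOn (hmax q).2
      (isMaxOn_iff.2 fun x hx => hmy x hx) (hmax q).1 hy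
  refine ⟨fun q => q ⬝ᵥ f q - h (f q), ?_, fun q => (hmax q).1, fun q q' => ?_, fun q c => ?_, ?_⟩
  -- Any limit of maximizers is a maximizer at `q`, and strict convexity leaves only `f q`.
  · refine continuous_iff_continuousAt.2 fun q => (tendsto_iff_ultrafilter _ _ _).2 fun 𝒰 h𝒰 => ?_
    obtain ⟨y, hy, hlim⟩ := isCompact_iff_ultrafilter_le_nhds'.1 (isCompact_stdSimplex ℝ (Fin d))
      (𝒰.map f) (Ultrafilter.mem_map.2 (univ_mem' fun q => (hmax q).1))
    have hlim : Tendsto f 𝒰 (𝓝 y) := hlim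
    have hlim' : Tendsto (fun q => h (f q)) 𝒰 (𝓝 (h y)) := (hcont y hy).tendsto.comp
      (tendsto_nhdsWithin_iff.2 ⟨hlim, Eventually.of_forall fun q => (hmax q).1⟩)
    have hq : Tendsto (fun q : Fin d → ℝ => q) 𝒰 (𝓝 q) := h𝒰
    have hdot : ∀ {a b : (Fin d → ℝ) → (Fin d → ℝ)} {a₀ b₀ : Fin d → ℝ}, Tendsto a 𝒰 (𝓝 a₀) →
        Tendsto b 𝒰 (𝓝 b₀) → Tendsto (fun q => a q ⬝ᵥ b q) 𝒰 (𝓝 (a₀ ⬝ᵥ b₀)) := fun ha hb =>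
      tendsto_finsetSum _ fun j _ => (tendsto_pi_nhds.1 ha j).mul (tendsto_pi_nhds.1 hb j)
    rw [huniq q y hy fun x hx => ?_]
    · exact hlim
    · exact le_of_tendsto_of_tendsto ((hdot hq tendsto_const_nhds).sub_const _)
        ((hdot hq hlim).sub hlim') (Eventually.of_forall fun q => hval q x hx)
  · have := hval q' (f q) (hmax q).1
    rw [dotProduct_sub, dotProduct_comm (f q) q', dotProduct_comm (f q) q]
    linarith
  · refine huniq _ _ (hmax q).1 fun x hx => ?_
    have e : ∀ x ∈ stdSimplex ℝ (Fin d), (fun j => q j + c) ⬝ᵥ x = q ⬝ᵥ x + c := fun x hx => by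
      have : (fun j => q j + c) = q + fun _ => c := rfl
      rw [this, add_dotProduct, dotProduct_comm (fun _ => c),
        dotProduct_const_of_mem_stdSimplex hx]
    rw [e x hx, e _ (hmax q).1]
    linarith [hval q x hx]
  · obtain ⟨C, hC⟩ := (isCompact_stdSimplex ℝ (Fin d)).exists_bound_of_continuousOn hcont
    refine ⟨C, fun q j => ?_⟩
    have h1 := single_mem_stdSimplex ℝ j
    have h2 := hval q _ h1
    have h3 := (abs_le.1 (hC _ h1)).2
    simp only [dotProduct_single, mul_one] at h2
    linarith

/-- Every condition in `IsPotential` survives convex combinations, so no regularizer for the mixture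
is needed. -/
theorem IsConvexCombFTRL.exists_isPotential (hf : IsConvexCombFTRL f) : ∃ Φ, IsPotential f Φ := by
  obtain ⟨k, α, g, hα, hsum, hg, hfg⟩ := hf
  choose Ψ hΨ using fun l => (hg l).exists_isPotential
  obtain rfl : f = fun q => ∑ l, α l • g l q := funext hfg
  choose C hC using fun l => (hΨ l).growth
  refine ⟨fun q => ∑ l, α l * Ψ l q, ?_, fun q => ?_, fun q q' => ?_, fun q c => ?_,
    ∑ l, α l * C l, fun q j => ?_⟩
  · exact continuous_finsetSum _ fun l _ => (hΨ l).continuous.const_smul (α l)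
  · exact (convex_stdSimplex ℝ (Fin d)).sum_mem (fun l _ => hα l) hsum fun l _ => (hΨ l).mem q
  · rw [sum_dotProduct, ← Finset.sum_sub_distrib]
    refine Finset.sum_le_sum fun l _ => ?_
    rw [smul_dotProduct, smul_eq_mul, ← mul_sub]
    exact mul_le_mul_of_nonneg_left ((hΨ l).subgradient q q') (hα l)
  · simp only [(hΨ _).shift]
  · calc q j - ∑ l, α l * C l = ∑ l, α l * (q j - C l) := by
          simp only [mul_sub, Finset.sum_sub_distrib, ← Finset.sum_mul, hsum, one_mul]
      _ ≤ _ := Finset.sum_le_sum fun l _ => mul_le_mul_of_nonneg_left (hC l q j) (hα l)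

/-- The linear form `v ↦ x ⬝ᵥ v`. -/
noncomputable def dotForm (x : Fin d → ℝ) : (Fin d → ℝ) →L[ℝ] ℝ :=
  ∑ j, x j • ContinuousLinearMap.proj j

@[simp] theorem dotForm_apply (x v : Fin d → ℝ) : dotForm x v = x ⬝ᵥ v := by
  simp [dotForm, dotProduct]

theorem abs_dotProduct_le (x v : Fin d → ℝ) : |x ⬝ᵥ v| ≤ d * ‖x‖ * ‖v‖ := by
  calc |x ⬝ᵥ v| ≤ ∑ j, |x j * v j| := Finset.abs_sum_le_sum_abs _ _
    _ ≤ ∑ _j : Fin d, ‖x‖ * ‖v‖ := Finset.sum_le_sum fun j _ => by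
        rw [abs_mul]; exact mul_le_mul (norm_le_pi_norm x j) (norm_le_pi_norm v j) (abs_nonneg _)
          (norm_nonneg _)
    _ = _ := by simp [mul_assoc]

namespace IsPotential

/-- The subgradients at `q` and `q'` squeeze the linearization error between `0` and `(f q' - f q)
⬝ᵥ (q' - q)`, which is small by continuity of `f`. -/
theorem hasFDerivAt (h : IsPotential f Φ) (q : Fin d → ℝ) : HasFDerivAt Φ (dotForm (f q)) q := by
  rw [hasFDerivAt_iff_isLittleO, Asymptotics.isLittleO_iff]
  intro c hc
  have h1 : ∀ᶠ q' in 𝓝 q, ‖f q' - f q‖ < c / (d + 1) := by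
    have := Metric.tendsto_nhds.1 (h.continuous.tendsto q) (c / (d + 1)) (by positivity)
    simpa only [dist_eq_norm] using this
  filter_upwards [h1] with q' hq'
  have e1 := h.subgradient q q'
  have e2 := h.subgradient q' q
  have e3 := abs_dotProduct_le (f q' - f q) (q' - q)
  have e4 : f q' ⬝ᵥ (q - q') = -(f q' ⬝ᵥ (q' - q)) := by rw [← dotProduct_neg, neg_sub]
  rw [sub_dotProduct] at e3
  have e5 : d * ‖f q' - f q‖ * ‖q' - q‖ ≤ c * ‖q' - q‖ := by
    refine mul_le_mul_of_nonneg_right ?_ (norm_nonneg _)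
    rw [lt_div_iff₀ (by positivity)] at hq'
    nlinarith [norm_nonneg (f q' - f q)]
  rw [dotForm_apply, Real.norm_eq_abs, abs_of_nonneg (by linarith)]
  linarith [le_abs_self (f q' ⬝ᵥ (q' - q) - f q ⬝ᵥ (q' - q))]

theorem continuous_potential (h : IsPotential f Φ) : Continuous Φ :=
  continuous_iff_continuousAt.2 fun q => (h.hasFDerivAt q).continuousAt

theorem add_const (h : IsPotential f Φ) (q : Fin d → ℝ) (c : ℝ) :
    Φ (fun j => q j + c) = Φ q + c := by
  have e1 := h.subgradient q (fun j => q j + c)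
  have e2 := h.subgradient (fun j => q j + c) q
  have d1 : (fun j => q j + c) - q = fun _ => c := by ext; simp
  have d2 : q - (fun j => q j + c) = fun _ => -c := by ext; simp
  rw [d1, dotProduct_const_of_mem_stdSimplex (h.mem _)] at e1
  rw [d2, dotProduct_const_of_mem_stdSimplex (h.mem _)] at e2
  linarith

/-- If `M` is the largest entry of `q`, growth gives `Φ q - y ⬝ᵥ q + C ≥ M - y ⬝ᵥ q = ∑ j, y j * (M
- q j)`, a sum of nonnegative terms each of which it dominates. -/
theorem exists_lower_bound (h : IsPotential f Φ) {y : Fin d → ℝ}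
    (hy : y ∈ stdSimplex ℝ (Fin d)) : ∃ C, ∀ q, -C ≤ Φ q - y ⬝ᵥ q ∧
      ∀ i j, y j * (q i - q j) ≤ Φ q - y ⬝ᵥ q + C := by
  obtain ⟨C, hC⟩ := h.growth
  refine ⟨C, fun q => ?_⟩
  have key : ∀ M, (∀ j, q j ≤ M) → M ≤ Φ q + C → -C ≤ Φ q - y ⬝ᵥ q ∧
      ∀ i j, y j * (q i - q j) ≤ Φ q - y ⬝ᵥ q + C := by
    intro M hM hMΦ
    have hs : ∑ j, y j * (M - q j) = M - y ⬝ᵥ q := by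
      simp [mul_sub, Finset.sum_sub_distrib, ← Finset.sum_mul, hy.2, dotProduct]
    have hn : ∀ j ∈ Finset.univ, 0 ≤ y j * (M - q j) := fun j _ =>
      mul_nonneg (hy.1 j) (sub_nonneg.2 (hM j))
    refine ⟨by linarith [Finset.sum_nonneg hn], fun i j => ?_⟩
    have := Finset.single_le_sum hn (Finset.mem_univ j)
    have := mul_le_mul_of_nonneg_left (sub_le_sub_right (hM i) (q j)) (hy.1 j)
    linarith
  have : Nonempty (Fin d) := by
    by_contra hne
    rw [not_nonempty_iff] at hne
    simpa using hy.2
  obtain ⟨i, hi⟩ := Finite.exists_max q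
  exact key (q i) hi (by linarith [hC q i])

/-- Positive weights turn the previous bound into one on the oscillation of `q`. One entry must be
controlled separately, because `Φ q - y ⬝ᵥ q` is constant along the diagonal. -/
theorem exists_norm_le (h : IsPotential f Φ) {y : Fin d → ℝ} (hy : y ∈ stdSimplex ℝ (Fin d))
    (hpos : ∀ j, 0 < y j) (j₀ : Fin d) (R : ℝ) :
    ∃ B, ∀ q : Fin d → ℝ, |q j₀| ≤ R → Φ q - y ⬝ᵥ q ≤ R → ‖q‖ ≤ B := by
  obtain ⟨C, hC⟩ := h.exists_lower_bound hy
  have : Nonempty (Fin d) := ⟨j₀⟩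
  obtain ⟨k, hk⟩ := Finite.exists_min y
  refine ⟨R + (R + C) / y k, fun q hq hR => ?_⟩
  have hRC : 0 ≤ R + C := by linarith [(hC q).1]
  have hdiff : ∀ i j, q i - q j ≤ (R + C) / y k := fun i j => by
    rw [le_div_iff₀ (hpos k)]
    rcases le_total (q i) (q j) with hij | hij
    · nlinarith [hpos k]
    · nlinarith [(hC q).2 i j, hk j]
  have hq' := abs_le.1 hq
  refine (pi_norm_le_iff_of_nonneg (add_nonneg ((abs_nonneg _).trans hq)
    (div_nonneg hRC (hpos k).le))).2 fun j => abs_le.2 ⟨?_, ?_⟩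
  · linarith [hdiff j₀ j]
  · linarith [hdiff j j₀]

/-- The gradient of `Φ q - y ⬝ᵥ q` is `f q - y`, so a minimizer suffices; by diagonal invariance it
may be sought in the slice `q j₀ = 0`, where sublevel sets are bounded. -/
theorem exists_eq_of_pos (h : IsPotential f Φ) {y : Fin d → ℝ} (hy : y ∈ stdSimplex ℝ (Fin d))
    (hpos : ∀ j, 0 < y j) (j₀ : Fin d) : ∃ q, f q = y := by
  obtain ⟨B, hB⟩ := h.exists_norm_le hy hpos j₀ |Φ 0|
  have hG : Continuous fun q => Φ q - y ⬝ᵥ q := by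
    simpa only [dotForm_apply] using h.continuous_potential.fun_sub (dotForm y).continuous
  have hK : IsCompact ({q : Fin d → ℝ | q j₀ = 0} ∩ Metric.closedBall 0 B) :=
    (isCompact_closedBall _ _).inter_left (isClosed_eq (continuous_apply j₀) continuous_const)
  have h0 : (0 : Fin d → ℝ) ∈ {q : Fin d → ℝ | q j₀ = 0} ∩ Metric.closedBall 0 B :=
    ⟨rfl, mem_closedBall_zero_iff.2 (hB 0 (by simp) (by simpa using le_abs_self (Φ 0)))⟩
  obtain ⟨q, -, hq⟩ := hK.exists_isMinOn ⟨0, h0⟩ hG.continuousOn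
  have hmin : ∀ p : Fin d → ℝ, Φ q - y ⬝ᵥ q ≤ Φ p - y ⬝ᵥ p := by
    intro p
    have hp : Φ (fun j => p j + -p j₀) - y ⬝ᵥ (fun j => p j + -p j₀) = Φ p - y ⬝ᵥ p := by
      have : (fun j => p j + -p j₀) = p + fun _ => -p j₀ := rfl
      rw [h.add_const, this, dotProduct_add, dotProduct_const_of_mem_stdSimplex hy]; ring
    rw [← hp]
    by_cases hle : Φ (fun j => p j + -p j₀) - y ⬝ᵥ (fun j => p j + -p j₀) ≤ |Φ 0|
    · exact hq ⟨by simp, mem_closedBall_zero_iff.2 (hB _ (by simp) hle)⟩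
    · have := hq h0
      simp only [Set.mem_ofPred_eq, dotProduct_zero, sub_zero] at this
      linarith [le_abs_self (Φ 0)]
  have hd : HasFDerivAt (fun q => Φ q - dotForm y q) (dotForm (f q) - dotForm y) q :=
    (h.hasFDerivAt q).sub (dotForm y).hasFDerivAt
  have hz := IsLocalMin.hasFDerivAt_eq_zero (Eventually.of_forall fun p => by simpa using hmin p) hd
  refine ⟨q, funext fun j => ?_⟩
  have := congrArg (fun L => L (Pi.single j 1)) hz
  simpa [sub_eq_zero] using this

end IsPotential

end Potential

/-! ### Conservation laws and recurrence of the game dynamics -/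

section Game

variable {m : ℕ} {n : Fin m → ℕ} {A : EdgeGames n}
  {f : ∀ i, (Fin (n i) → ℝ) → (Fin (n i) → ℝ)}

theorem dotProduct_mulVec_add_of_constantSum {a b : ℕ} {A : Matrix (Fin a) (Fin b) ℝ}
    {B : Matrix (Fin b) (Fin a) ℝ} {c : ℝ} (h : ∀ j l, A j l + B l j = c)
    {x : Fin a → ℝ} (hx : x ∈ stdSimplex ℝ (Fin a)) {y : Fin b → ℝ}
    (hy : y ∈ stdSimplex ℝ (Fin b)) : x ⬝ᵥ A.mulVec y + y ⬝ᵥ B.mulVec x = c := by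
  have hA : x ⬝ᵥ A.mulVec y = ∑ j, ∑ l, x j * y l * A j l := by
    simp only [dotProduct, Matrix.mulVec, Finset.mul_sum]
    exact Finset.sum_congr rfl fun j _ => Finset.sum_congr rfl fun l _ => by ring
  have hB : y ⬝ᵥ B.mulVec x = ∑ j, ∑ l, x j * y l * B l j := by
    simp only [dotProduct, Matrix.mulVec, Finset.mul_sum]
    rw [Finset.sum_comm]
    exact Finset.sum_congr rfl fun j _ => Finset.sum_congr rfl fun l _ => by ring
  rw [hA, hB, ← Finset.sum_add_distrib]
  simp_rw [← Finset.sum_add_distrib, ← mul_add, h, ← Finset.sum_mul, ← Finset.mul_sum, hy.2,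
    mul_one, hx.2, one_mul]

/-- The total payoff of the strategies `x` against the strategies `y`. -/
def totalPayoff (A : EdgeGames n) (x y : Profile n) : ℝ :=
  ∑ i, x i ⬝ᵥ gamePayoff A y i

theorem IsConstantSum.exists_totalPayoff_add (hA : IsConstantSum A) :
    ∃ C, ∀ x ∈ strategySpace n, ∀ y ∈ strategySpace n,
      totalPayoff A x y + totalPayoff A y x = C := by
  choose! c hc using hA
  have hsum : ∀ x y, totalPayoff A x y
      = ∑ i, ∑ k, if k ≠ i then x i ⬝ᵥ (A i k).mulVec (y k) else 0 := by
    intro x y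
    refine Finset.sum_congr rfl fun i _ => ?_
    rw [gamePayoff, dotProduct_sum, ← Finset.sum_filter, Finset.filter_ne']
  refine ⟨∑ i, ∑ k, if k ≠ i then c i k else 0, fun x hx y hy => ?_⟩
  rw [hsum x y, hsum y x, Finset.sum_comm (γ := Fin m) (f := fun i k => if k ≠ i then
    y i ⬝ᵥ (A i k).mulVec (x k) else 0), ← Finset.sum_add_distrib]
  refine Finset.sum_congr rfl fun i _ => ?_
  rw [← Finset.sum_add_distrib]
  refine Finset.sum_congr rfl fun k _ => ?_
  by_cases h : k = i
  · simp [h]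
  · rw [if_pos h, if_pos (Ne.symm h), if_pos h]
    exact dotProduct_mulVec_add_of_constantSum (hc i k (Ne.symm h)) (hx i) (hy k)

/-- The payoff gaps of the actions are nonnegative and average to zero under positive weights, so
all actions pay the same. -/
theorem IsNash.dotProduct_eq {x : Profile n} (hx : IsNash A x) (hpos : ∀ i j, 0 < x i j)
    (i : Fin m) {y : Fin (n i) → ℝ} (hy : y ∈ stdSimplex ℝ (Fin (n i))) :
    y ⬝ᵥ gamePayoff A x i = x i ⬝ᵥ gamePayoff A x i := by
  set u := gamePayoff A x i with hu
  have hle : ∀ j, 0 ≤ x i ⬝ᵥ u - u j := fun j => by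
    simpa using hx.2 i _ (single_mem_stdSimplex ℝ j)
  have hs : ∑ j, x i j * (x i ⬝ᵥ u - u j) = 0 := by
    simp only [mul_sub, Finset.sum_sub_distrib, ← Finset.sum_mul, (hx.1 i).2, one_mul]
    simp [dotProduct]
  have hz : u = fun _ => x i ⬝ᵥ u := by
    funext j
    have := (Finset.sum_eq_zero_iff_of_nonneg
      (fun j _ => mul_nonneg (hpos i j).le (hle j))).1 hs j (Finset.mem_univ j)
    rcases mul_eq_zero.1 this with h | h
    · exact absurd h (hpos i j).ne'
    · linarith
  conv_lhs => rw [hz]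
  exact dotProduct_const_of_mem_stdSimplex hy _

/-- With `T` the total payoff, `T y y = C / 2` and `T x y = C - T y x = C - T x x = C / 2`, where `T
y x = T x x` because `x` is fully mixed. -/
theorem IsConstantSum.sum_sub_dotProduct_eq_zero (hA : IsConstantSum A) {x : Profile n}
    (hx : IsNash A x) (hpos : ∀ i j, 0 < x i j) {y : Profile n} (hy : y ∈ strategySpace n) :
    ∑ i, (y i - x i) ⬝ᵥ gamePayoff A y i = 0 := by
  obtain ⟨C, hC⟩ := hA.exists_totalPayoff_add
  have h1 := hC y hy y hy
  have h2 := hC x hx.1 y hy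
  have h3 := hC x hx.1 x hx.1
  have h4 : totalPayoff A y x = totalPayoff A x x :=
    Finset.sum_congr rfl fun i _ => hx.dotProduct_eq hpos i (hy i)
  simp only [sub_dotProduct, Finset.sum_sub_distrib]
  change totalPayoff A y y - totalPayoff A x y = 0
  linarith

/-- The part of the payoffs that is due to the strategy `x` of agent `k`, normalized such that the
action `a i` of agent `i` has payoff zero. -/
noncomputable def normalizedEdgePayoff (A : EdgeGames n) (a : ∀ i, Fin (n i)) (k : Fin m)
    (x : Fin (n k) → ℝ) : Profile n :=
  fun i j => if k = i then 0 else (A i k).mulVec x j - (A i k).mulVec x (a i)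

/-- The payoffs, normalized such that the action `a i` of agent `i` has payoff zero. -/
def normalizedPayoff (A : EdgeGames n) (a : ∀ i, Fin (n i)) (x : Profile n) : Profile n :=
  fun i j => gamePayoff A x i j - gamePayoff A x i (a i)

theorem sum_normalizedEdgePayoff (A : EdgeGames n) (a : ∀ i, Fin (n i)) (x : Profile n) :
    ∑ k, normalizedEdgePayoff A a k (x k) = normalizedPayoff A a x := by
  ext i j
  simp only [normalizedPayoff, normalizedEdgePayoff, gamePayoff, Finset.sum_apply,
    ← Finset.sum_sub_distrib]
  rw [← Finset.sum_erase Finset.univ (a := i) (by simp)]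
  exact Finset.sum_congr rfl fun k hk => by rw [if_neg (Finset.ne_of_mem_erase hk)]

theorem continuous_normalizedEdgePayoff (A : EdgeGames n) (a : ∀ i, Fin (n i)) (k : Fin m) :
    Continuous (normalizedEdgePayoff A a k) := by
  refine continuous_pi fun i => continuous_pi fun j => ?_
  unfold normalizedEdgePayoff
  split_ifs
  · exact continuous_const
  · have h : Continuous fun x => (A i k).mulVec x := continuous_const.matrix_mulVec continuous_id
    exact ((continuous_apply j).comp h).sub ((continuous_apply (a i)).comp h)

theorem continuous_gamePayoff (A : EdgeGames n) : Continuous (gamePayoff A) :=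
  continuous_pi fun _ => continuous_finsetSum _ fun k _ =>
    continuous_const.matrix_mulVec (continuous_apply k)

/-- The vector field of the normalized game dynamics. -/
def normalizedField (A : EdgeGames n) (f : ∀ i, (Fin (n i) → ℝ) → (Fin (n i) → ℝ))
    (a : ∀ i, Fin (n i)) (q : Profile n) : Profile n :=
  normalizedPayoff A a (strategyOf f q)

/-- The contribution of agent `k` to the field is a shear along `k`, bounded because her strategies
stay in a compact simplex. -/
theorem exists_isConsistent_normalizedField (A : EdgeGames n) (hf : ∀ i, Continuous (f i))
    (hmem : ∀ i q, f i q ∈ stdSimplex ℝ (Fin (n i))) (a : ∀ i, Fin (n i)) :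
    ∃ S M, IsConsistent S (normalizedField A f a) M ∧
      ∀ h, MeasurePreserving (S h) volume volume := by
  obtain ⟨S, M, h1, h2⟩ := exists_isConsistent_measurePreserving
    (w := fun k x => normalizedEdgePayoff A a k (f k x))
    (fun k => (continuous_normalizedEdgePayoff A a k).comp (hf k))
    (fun k => by
      obtain ⟨C, hC⟩ := (isCompact_stdSimplex ℝ (Fin (n k))).exists_bound_of_continuousOn
        (continuous_normalizedEdgePayoff A a k).continuousOn
      exact ⟨C, fun x => hC _ (hmem k x)⟩)
    (fun k x => by ext j; simp [normalizedEdgePayoff])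
  refine ⟨S, M, ?_, h2⟩
  convert h1 using 2 with q
  exact (sum_normalizedEdgePayoff A a (strategyOf f q)).symm

theorem HasDerivWithinAt.eq_of_zero {g : ℝ → ℝ}
    (hg : ∀ t, 0 ≤ t → HasDerivWithinAt g 0 (Set.Ici 0) t) {t : ℝ} (ht : 0 ≤ t) : g t = g 0 :=
  constant_of_has_deriv_right_zero
    (fun s hs => ((hg s hs.1).continuousWithinAt).mono Set.Icc_subset_Ici_self)
    (fun s hs => (hg s hs.1).mono (Set.Ici_subset_Ici.2 hs.1)) t ⟨ht, le_rfl⟩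

theorem IsSolution.apply_eq_of_normalizedField {a : ∀ i, Fin (n i)} {r : ℝ → Profile n}
    (hr : IsSolution (normalizedField A f a) r) {t : ℝ} (ht : 0 ≤ t) (i : Fin m) :
    r t i (a i) = r 0 i (a i) := by
  refine HasDerivWithinAt.eq_of_zero (g := fun t => r t i (a i)) (fun s hs => ?_) ht
  have := hasDerivWithinAt_pi.1 (hasDerivWithinAt_pi.1 (hr s hs) i) (a i)
  simpa [normalizedField, normalizedPayoff] using this

/-- Adding back the payoffs of the distinguished actions turns solutions of the normalized game
dynamics into trajectories. -/
theorem IsSolution.exists_isTrajectory {a : ∀ i, Fin (n i)} (hf : ∀ i, Continuous (f i))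
    (hshift : ∀ i q (c : ℝ), f i (fun j => q j + c) = f i q) {r : ℝ → Profile n}
    (hr : IsSolution (normalizedField A f a) r) :
    ∃ c : ℝ → Fin m → ℝ, IsTrajectory A f (fun t i j => r t i j + c t i) ∧ c 0 = 0 := by
  -- Extending `r` by its value at `0` makes the integrand continuous on the whole line, so the
  -- integral is differentiable also at `t = 0`.
  let u : Fin m → ℝ → ℝ := fun i s => gamePayoff A (strategyOf f (r (max s 0))) i (a i)
  have hrc : Continuous fun s : ℝ => r (max s 0) := by
    have h : ContinuousOn r (Set.Ici 0) := fun t ht => (hr t ht).continuousWithinAt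
    exact h.comp_continuous (continuous_id.max continuous_const) fun s => le_max_right s 0
  have hu : ∀ i, Continuous (u i) := fun i => by
    have h1 : Continuous (strategyOf f) :=
      continuous_pi fun i => (hf i).comp (continuous_apply i)
    have h2 : Continuous fun s : ℝ => gamePayoff A (strategyOf f (r (max s 0))) :=
      (continuous_gamePayoff A).comp (h1.comp hrc)
    exact (continuous_apply (a i)).comp ((continuous_apply i).comp h2)
  refine ⟨fun t i => ∫ s in (0 : ℝ)..t, u i s, fun t ht => ?_, by ext; simp⟩
  have hstr : ∀ c : Fin m → ℝ, strategyOf f (fun i j => r t i j + c i) = strategyOf f (r t) :=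
    fun c => funext fun i => hshift i _ _
  rw [hstr, hasDerivWithinAt_pi]
  refine fun i => hasDerivWithinAt_pi.2 fun j => ?_
  have h1 := hasDerivWithinAt_pi.1 (hasDerivWithinAt_pi.1 (hr t ht) i) j
  have h2 := ((hu i).integral_hasStrictDerivAt 0 t).hasDerivAt.hasDerivWithinAt (s := Set.Ici 0)
  have := h1.fun_add h2
  simpa [normalizedField, normalizedPayoff, u, max_eq_left ht] using this

/-- The lifted trajectories agree, so `r` and `r'` differ by one constant per agent; the frozen
entry `a i` shows that it is zero. -/
theorem HasUniqueTrajectories.normalizedField (huniq : HasUniqueTrajectories A f)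
    (hf : ∀ i, Continuous (f i)) (hshift : ∀ i q (c : ℝ), f i (fun j => q j + c) = f i q)
    {a : ∀ i, Fin (n i)} (r r' : ℝ → Profile n) (hr : IsSolution (normalizedField A f a) r)
    (hr' : IsSolution (normalizedField A f a) r') (h0 : r 0 = r' 0) :
    ∀ t, 0 ≤ t → r t = r' t := by
  intro t ht
  obtain ⟨c, hc, hc0⟩ := hr.exists_isTrajectory hf hshift
  obtain ⟨c', hc', hc0'⟩ := hr'.exists_isTrajectory hf hshift
  have h := huniq _ _ hc hc' (by simp [h0, hc0, hc0']) t ht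
  ext i j
  have h1 := congrFun (congrFun h i) j
  have h2 := congrFun (congrFun h i) (a i)
  have h3 := hr.apply_eq_of_normalizedField ht i
  have h4 := hr'.apply_eq_of_normalizedField ht i
  rw [h0] at h3
  linarith

/-- The total regret potential with respect to the strategies `x`. -/
def energy (Φ : ∀ i, (Fin (n i) → ℝ) → ℝ) (x q : Profile n) : ℝ :=
  ∑ i, (Φ i (q i) - x i ⬝ᵥ q i)

/-- Normalization changes payoffs by constant vectors, which differences of points of the simplex do
not see. -/
theorem IsSolution.energy_eq {Φ : ∀ i, (Fin (n i) → ℝ) → ℝ} (hΦ : ∀ i, IsPotential (f i) (Φ i))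
    (hA : IsConstantSum A) {x : Profile n} (hx : IsNash A x) (hpos : ∀ i j, 0 < x i j)
    {a : ∀ i, Fin (n i)} {r : ℝ → Profile n} (hr : IsSolution (normalizedField A f a) r)
    {t : ℝ} (ht : 0 ≤ t) : energy Φ x (r t) = energy Φ x (r 0) := by
  refine HasDerivWithinAt.eq_of_zero (g := fun t => energy Φ x (r t)) (fun s hs => ?_) ht
  have hd : ∀ i, HasDerivWithinAt (fun t => Φ i (r t i) - dotForm (x i) (r t i))
      ((f i (r s i) - x i) ⬝ᵥ gamePayoff A (strategyOf f (r s)) i) (Set.Ici 0) s := by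
    intro i
    have h1 := hasDerivWithinAt_pi.1 (hr s hs) i
    have h2 := ((hΦ i).hasFDerivAt (r s i)).comp_hasDerivWithinAt s h1
    have h3 := (dotForm (x i)).hasFDerivAt.comp_hasDerivWithinAt s h1
    refine (h2.fun_sub h3).congr_deriv ?_
    have e : normalizedField A f a (r s) i = gamePayoff A (strategyOf f (r s)) i
        - fun _ => gamePayoff A (strategyOf f (r s)) i (a i) := rfl
    rw [dotForm_apply, dotForm_apply, e, dotProduct_sub, dotProduct_sub,
      dotProduct_const_of_mem_stdSimplex ((hΦ i).mem _),
      dotProduct_const_of_mem_stdSimplex (hx.1 i), sub_dotProduct]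
    ring
  have := HasDerivWithinAt.fun_sum fun i (_ : i ∈ Finset.univ) => hd i
  simp only [dotForm_apply] at this
  refine this.congr_deriv ?_
  exact hA.sum_sub_dotProduct_eq_zero hx hpos fun i => (hΦ i).mem _

/-- Each agent's summand is bounded below, so a bound on the sum bounds every summand. -/
theorem isBounded_sublevel_energy {Φ : ∀ i, (Fin (n i) → ℝ) → ℝ}
    (hΦ : ∀ i, IsPotential (f i) (Φ i)) {x : Profile n} (hx : x ∈ strategySpace n)
    (hpos : ∀ i j, 0 < x i j) (a : ∀ i, Fin (n i)) (R : ℝ) :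
    Bornology.IsBounded {q | energy Φ x q + ∑ i, |q i (a i)| ≤ R} := by
  choose C hC using fun i => (hΦ i).exists_lower_bound (hx i)
  have hnn : ∀ (q : Profile n) i, 0 ≤ Φ i (q i) - x i ⬝ᵥ q i + |C i| + |q i (a i)| := fun q i => by
    linarith [(hC i (q i)).1, le_abs_self (C i), abs_nonneg (q i (a i))]
  set R' := R + ∑ i, |C i| with hR'
  choose B hB using fun i => (hΦ i).exists_norm_le (hx i) (hpos i) (a i) R'
  refine (Metric.isBounded_closedBall (x := (0 : Profile n)) (r := ∑ i, |B i|)).subset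
    fun q hq => ?_
  have hterm : ∀ i, Φ i (q i) - x i ⬝ᵥ q i + |C i| + |q i (a i)| ≤ R' := fun i => by
    refine (Finset.single_le_sum (fun i _ => hnn q i) (Finset.mem_univ i)).trans ?_
    simp only [Set.mem_ofPred_eq, energy] at hq
    simp only [Finset.sum_add_distrib, hR'] at hq ⊢
    linarith
  rw [mem_closedBall_zero_iff, pi_norm_le_iff_of_nonneg (Finset.sum_nonneg fun i _ => abs_nonneg _)]
  intro i
  have h1 := hB i (q i) (by linarith [hterm i, (hC i (q i)).1, le_abs_self (C i)])
    (by linarith [hterm i, abs_nonneg (C i), abs_nonneg (q i (a i))])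
  exact h1.trans ((le_abs_self _).trans
    (Finset.single_le_sum (f := fun i => |B i|) (fun i _ => abs_nonneg _) (Finset.mem_univ i)))

/-- Almost all initial conditions lead to recurrent strategies. -/
theorem ae_exists_isTrajectory_frequently {Φ : ∀ i, (Fin (n i) → ℝ) → ℝ}
    (hΦ : ∀ i, IsPotential (f i) (Φ i)) (hA : IsConstantSum A) {x : Profile n}
    (hx : IsNash A x) (hpos : ∀ i j, 0 < x i j) (a : ∀ i, Fin (n i))
    (huniq : HasUniqueTrajectories A f) :
    ∀ᵐ q₀ : Profile n ∂volume, ∃ q : ℝ → Profile n, IsTrajectory A f q ∧ q 0 = q₀ ∧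
      ∀ U ∈ 𝓝 (strategyOf f q₀), ∃ᶠ t in atTop, strategyOf f (q t) ∈ U := by
  have hf : ∀ i, Continuous (f i) := fun i => (hΦ i).continuous
  have hshift : ∀ i q (c : ℝ), f i (fun j => q j + c) = f i q := fun i => (hΦ i).shift
  have huniq' := huniq.normalizedField hf hshift (a := a)
  obtain ⟨S, M, hS, hvol⟩ :=
    exists_isConsistent_normalizedField A hf (fun i => (hΦ i).mem) a
  obtain ⟨Ψ, hΨ⟩ := hS.exists_flow huniq'
  have hmp : MeasurePreserving (fun q => Ψ q 1) volume volume :=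
    hS.measurePreserving_flow hvol zero_le_one fun q => (hΨ q).2.2 1 zero_le_one
  have hG : Continuous fun q : Profile n => energy Φ x q + ∑ i, |q i (a i)| := by
    refine .add (continuous_finsetSum _ fun i _ => ?_) (continuous_finsetSum _ fun i _ => ?_)
    · have h := (hΦ i).continuous_potential.fun_sub (dotForm (x i)).continuous
      simp only [dotForm_apply] at h
      exact h.comp (continuous_apply i)
    · exact ((continuous_apply (a i)).comp (continuous_apply i)).abs
  have hrec := hmp.ae_frequently_mem_of_isBounded_sublevel hG
    (isBounded_sublevel_energy hΦ hx.1 hpos a) fun q => by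
      have h := (hΨ q).1
      simp only [h.energy_eq hΦ hA hx hpos zero_le_one, h.apply_eq_of_normalizedField zero_le_one,
        (hΨ q).2.1]
  filter_upwards [hrec] with q₀ hq₀
  obtain ⟨c, hc, hc0⟩ := (hΨ q₀).1.exists_isTrajectory hf hshift
  refine ⟨_, hc, by simp [hc0, (hΨ q₀).2.1], fun U hU => ?_⟩
  have hcont : Continuous (strategyOf f) := continuous_pi fun i => (hf i).comp (continuous_apply i)
  have hfreq := hq₀ _ (hcont.continuousAt hU)
  refine (tendsto_natCast_atTop_atTop (R := ℝ)).frequently (hfreq.mono fun k hk => ?_)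
  rw [iterate_flow_one huniq' fun q => ⟨(hΨ q).1, (hΨ q).2.1⟩] at hk
  have : strategyOf f (fun i j => Ψ q₀ k i j + c k i) = strategyOf f (Ψ q₀ k) :=
    funext fun i => hshift i _ _
  rwa [this]

/-- A small move along the segment towards `x` makes all entries positive. -/
theorem exists_pos_mem_of_isOpen {x : Profile n} (hx : x ∈ strategySpace n)
    (hpos : ∀ i j, 0 < x i j) {U : Set (Profile n)} (hU : IsOpen U)
    (hne : (U ∩ strategySpace n).Nonempty) :
    ∃ y ∈ U ∩ strategySpace n, ∀ i j, 0 < y i j := by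
  obtain ⟨z, hzU, hz⟩ := hne
  have hlim : Tendsto (fun s : ℝ => (1 - s) • z + s • x) (𝓝[>] 0) (𝓝 z) := by
    have : Continuous fun s : ℝ => (1 - s) • z + s • x := by fun_prop
    simpa using (this.tendsto 0).mono_left nhdsWithin_le_nhds
  obtain ⟨s, hsU, hs⟩ := ((hlim.eventually (hU.mem_nhds hzU)).and
    (Ioo_mem_nhdsGT (zero_lt_one' ℝ))).exists
  refine ⟨_, ⟨hsU, fun i => convex_stdSimplex ℝ _ (hz i) (hx i) (sub_nonneg.2 hs.2.le) hs.1.le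
    (sub_add_cancel _ _)⟩, fun i j => ?_⟩
  exact add_pos_of_nonneg_of_pos (mul_nonneg (sub_nonneg.2 hs.2.le) ((hz i).1 j))
    (mul_pos hs.1 (hpos i j))

end Game

theorem mainTheorem1 {m : ℕ} (n : Fin m → ℕ) (A : EdgeGames n)
    (f : ∀ i, (Fin (n i) → ℝ) → (Fin (n i) → ℝ))
    (hf : ∀ i, IsConvexCombFTRL (f i))
    (hA : IsConstantSum A)
    (hNash : ∃ x, IsNash A x ∧ ∀ i j, 0 < x i j)
    (huniq : HasUniqueTrajectories A f) :
    PoincareRecurrent A f := by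
  obtain ⟨x, hx, hpos⟩ := hNash
  choose Φ hΦ using fun i => (hf i).exists_isPotential
  have hne : ∀ i, Nonempty (Fin (n i)) := fun i => by
    by_contra h
    rw [not_nonempty_iff] at h
    simpa using (hx.1 i).2
  let a : ∀ i, Fin (n i) := fun i => (hne i).some
  have hrec := ae_exists_isTrajectory_frequently hΦ hA hx hpos a huniq
  refine ⟨?_, fun U hU hUne => ?_⟩
  · filter_upwards [hrec] with q₀ ⟨q, hq, hq0, h⟩
    exact ⟨q, hq, hq0, fun ε hε => h _ (Metric.ball_mem_nhds _ hε)⟩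
  · obtain ⟨y, ⟨hyU, hy⟩, hypos⟩ := exists_pos_mem_of_isOpen hx.1 hpos hU hUne
    choose p hp using fun i => (hΦ i).exists_eq_of_pos (hy i) (hypos i) (a i)
    have hcont : Continuous (strategyOf f) :=
      continuous_pi fun i => (hΦ i).continuous.comp (continuous_apply i)
    have hpU : p ∈ strategyOf f ⁻¹' U := by
      have : strategyOf f p = y := funext hp
      rwa [Set.mem_preimage, this]
    -- The point `p` itself may fail to be recurrent, but Lebesgue-almost every point is, and such
    -- points are dense.
    obtain ⟨q₀, hq₀U, q, hq, -, h⟩ := (Measure.dense_of_ae hrec).inter_open_nonempty _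
      (hU.preimage hcont) ⟨p, hpU⟩
    exact ⟨q, hq, h U (hU.mem_nhds hq₀U)⟩
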